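/- Consider two packet queues sharing a slotted collision channel. Fix $p_1,p_2\in[0,1]$ and $\lambda_1,\lambda_2\in(0,1)$. At the start of each slot a packet arrives at queue $i$ with probability $\lambda_i$; all arrivals and access decisions are independent. The system is in one of two phases. In the first-transmission phase $F$, queue 1 transmits with probability $p_1$ if it is non-empty (after the arrival), and queue 2 transmits with probability $p_2$, sending a dummy packet if it is empty (so that it is always backlogged). A packet transmitted alone is delivered; if both queues transmit, there is a collision, nothing is delivered, and the next slot is in the retransmission phase $R$. In phase $R$, queue 2 is silent and queue 1 transmits, and so delivers, its packet with probability 1. After every slot without a collision the next slot is in phase $F$. This is Dominant System 1. Let $k_F$, $k_R$ ($k\ge 0$) denote the states of queue 1 at the start of a slot: its length $k$ and the phase. These states form a Markov chain, and together with the number of real packets at queue 2 they form the Markov chain of the whole system. The empty system is in state $0_F$ with no packet at queue 2. A chain is called stable if the empty state is positive recurrent. 1. The Markov chain of queue 1 is stable if and only if $\lambda_1<\frac{p_1}{1+p_1p_2}$, and this is also equivalent to the existence of a stationary probability distribution of that chain. In that case the stationary distribution is unique, and with $$\rho=\frac{\lambda_1(1-p_1+\lambda_1p_1p_2)}{p_1(1-\lambda_1)(1-\lambda_1p_2)}\in[0,1)$$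 it is given by $$\pi(0_F)=\frac{p_1-\lambda_1(1+p_1p_2)}{p_1(1-\lambda_1)}>0,\qquad \pi(k_F)=\rho^k\,\pi(0_F)\quad(k\ge 0),$$ $$\pi(0_R)=0,\qquad \pi((k+1)_R)=\rho^{k}\,\frac{\lambda_1p_2}{1-\lambda_1p_2}\,\pi(0_F)\quad(k\ge0).$$ 2. In that case the service rate of queue 2, that is, the stationary probability that a (real or dummy) packet of queue 2 is transmitted without collision in a slot, equals $\mu_2=p_2(1-\lambda_1-\lambda_1p_2)$. 3. The whole system is stable if and only if $$\lambda_1<\frac{p_1}{1+p_1p_2}\qquad\text{and}\qquad\lambda_2<p_2(1-\lambda_1-\lambda_1p_2),$$ and this is also equivalent to the existence of a stationary probability distribution of its Markov chain. -/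

import Mathlib

open scoped ENNReal

namespace FeedbackAccess

/-! ### Discrete-time Markov chains on a set of states, given by a transition kernel -/

section MarkovChain

variable {S : Type*}

/-- `π` is a stationary (steady state) probability distribution of the chain with kernel `κ`. -/
def IsStationary (κ : S → PMF S) (π : PMF S) : Prop :=
  π.bind κ = π

open Classical in
/-- The probability that the chain with kernel `κ`, started in `y` at time `0`, is not in the
state `x` at any of the times `1, …, n`. -/
noncomputable def avoidProb (κ : S → PMF S) (x : S) : ℕ → S → ℝ≥0∞
  | 0, _ => 1
  | n + 1, y => ∑' z, κ y z * (if z = x then 0 else avoidProb κ x n z)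

/-- The expected first return time `E_x[T] = ∑_{n ≥ 0} P_x(T > n)` to the state `x`, where
`T = min {n ≥ 1 | X_n = x}`; it is `∞` if the chain fails to return with positive probability. -/
noncomputable def meanReturnTime (κ : S → PMF S) (x : S) : ℝ≥0∞ :=
  ∑' n, avoidProb κ x n x

/-- `x` is a positive recurrent state: its expected first return time is finite. -/
def IsPositiveRecurrent (κ : S → PMF S) (x : S) : Prop :=
  meanReturnTime κ x < ∞

end MarkovChain

/-! ### Random access with feedback when queue 2 is always backlogged -/

/-- Phase of the protocol. `first`: both queues use random access (first transmission).
`retrans`: the previous slot held a collision, so queue 1 retransmits and queue 2 backs off. -/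
inductive Phase
  | first
  | retrans
  deriving DecidableEq

/-- State of queue 1 at the beginning of a slot: its length and the current phase. -/
abbrev Queue1State := ℕ × Phase

/-- The fresh randomness of one slot: arrivals at the two queues, and the outcomes of the two
random access coins. -/
structure Slot where
  arrival1 : Bool
  arrival2 : Bool
  access1 : Bool
  access2 : Bool
  deriving DecidableEq

/-- A coin that shows `true` with probability `p`. -/
noncomputable def coin (p : unitInterval) : PMF Bool :=
  PMF.ofFintype (fun b => ENNReal.ofReal (if b then (p : ℝ) else 1 - p)) (by
    have h : (0 : ℝ) ≤ 1 - p := sub_nonneg.2 p.2.2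
    rw [Fintype.sum_bool]
    simp [← ENNReal.ofReal_add p.2.1 h])

/-- The law of the randomness of one slot: independent Bernoulli arrivals with means `l₁`, `l₂`
and independent access coins with probabilities `p₁`, `p₂`. -/
noncomputable def slotLaw (l₁ l₂ p₁ p₂ : unitInterval) : PMF Slot :=
  (coin l₁).bind fun a₁ => (coin l₂).bind fun a₂ =>
    (coin p₁).bind fun t₁ => (coin p₂).map fun t₂ => ⟨a₁, a₂, t₁, t₂⟩

/-- Number of packets at queue 1 after the arrival, which takes place at the start of the slot. -/
def backlog1 (s : Queue1State) (w : Slot) : ℕ :=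
  s.1 + w.arrival1.toNat

/-- Queue 1 transmits: it has a packet, and either its access coin allows it or it is
retransmitting a collided packet. -/
def sends1 (s : Queue1State) (w : Slot) : Bool :=
  match s.2 with
  | .first => decide (0 < backlog1 s w) && w.access1
  | .retrans => decide (0 < backlog1 s w)

/-- Queue 2 transmits a (real or dummy) packet: it always has one, but it is silent when it has to
back off. -/
def sends2 (s : Queue1State) (w : Slot) : Bool :=
  match s.2 with
  | .first => w.access2
  | .retrans => false

/-- The slot serves queue 2: queue 2 transmits and there is no collision. -/
def serves2 (s : Queue1State) (w : Slot) : Bool :=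
  sends2 s w && !sends1 s w

/-- State of queue 1 at the beginning of the next slot. -/
def next1 (s : Queue1State) (w : Slot) : Queue1State :=
  if sends1 s w = true then
    if sends2 s w = true then (backlog1 s w, .retrans) else (backlog1 s w - 1, .first)
  else (backlog1 s w, .first)

/-- Number of real packets at queue 2 at the beginning of the next slot, if it is `n` now. A served
slot removes a real packet if there is one after the arrival; otherwise a dummy was sent. -/
def next2 (s : Queue1State) (n : ℕ) (w : Slot) : ℕ :=
  n + w.arrival2.toNat - (serves2 s w).toNat

/-- The Markov chain of queue 1. -/
noncomputable def queue1Chain (l₁ l₂ p₁ p₂ : unitInterval) (s : Queue1State) :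
    PMF Queue1State :=
  (slotLaw l₁ l₂ p₁ p₂).map (next1 s)

/-- The Markov chain of the whole system: the state of queue 1 and the number of real packets at
queue 2. -/
noncomputable def systemChain (l₁ l₂ p₁ p₂ : unitInterval) (x : Queue1State × ℕ) :
    PMF (Queue1State × ℕ) :=
  (slotLaw l₁ l₂ p₁ p₂).map fun w => (next1 x.1 w, next2 x.1 x.2 w)

/-- The service rate of queue 2 when the state of queue 1 has law `π`: the probability that a slot
serves queue 2. -/
noncomputable def serviceRate2 (l₁ l₂ p₁ p₂ : unitInterval) (π : PMF Queue1State) : ℝ :=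
  ((π.bind fun s => (slotLaw l₁ l₂ p₁ p₂).map (serves2 s)) true).toReal

/-- The ratio of the geometric stationary distribution of queue 1. -/
noncomputable def ratio (l₁ p₁ p₂ : unitInterval) : ℝ :=
  (l₁ * (1 - p₁ + l₁ * p₁ * p₂)) / (p₁ * (1 - l₁) * (1 - l₁ * p₂))

end FeedbackAccess

/-! Since queue 2 always sends something in phase `first`, queue 1 evolves without regard to the
real packets at queue 2. Its balance equations reduce to equality of flow between neighbouring
lengths (`IsStationary.cut`). Eliminating the `retrans` states leaves a one-step linear recurrence,
so the law is geometric with the given ratio. Summability forces the ratio below 1 and total mass 1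
fixes the constant; conversely the geometric weights are invariant
(`exists_isStationary_queue1Chain`). The service rate of queue 2 is a sum against this law.

Positive recurrence and stationarity are linked in both directions: excursions from a positive
recurrent state have an invariant occupation measure, and a state visited with positive asymptotic
frequency has finite mean return time, by decomposition at the last visit.

For the system, necessity follows from `IsStationary.rate_balance`: service rate = arrival rate +
rate of dummies sent to an empty queue 2 in slots without an arrival there. The last rate is
positive because the empty state is charged, which makes the inequality strict. For sufficiency,
queue 1 is started stationary and queue 2 empty. Then the mean drift of queue 2 is at most `l₂ - μ₂`
(`μ₂` the claimed service rate) plus the probability that queue 2 is empty, so it is empty with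
positive frequency while queue 1 lies in a fixed finite set. From there the empty system is reached
with a probability bounded below. -/

namespace FeedbackAccess

/-! ### Positive recurrence and stationary distributions for general chains. -/

section MarkovChain

variable {S T : Type*}

/-- The expectation of `f` under `π`. -/
noncomputable def expect (π : PMF S) (f : S → ℝ≥0∞) : ℝ≥0∞ :=
  ∑' x, π x * f x

theorem expect_bind (π : PMF S) (κ : S → PMF T) (f : T → ℝ≥0∞) :
    expect (π.bind κ) f = expect π fun x => expect (κ x) f := by
  simp only [expect, PMF.bind_apply, ← ENNReal.tsum_mul_right, ← ENNReal.tsum_mul_left]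
  rw [ENNReal.tsum_comm]
  simp only [mul_assoc]

theorem expect_pure (x : S) (f : S → ℝ≥0∞) : expect (PMF.pure x) f = f x := by
  rw [expect, tsum_eq_single x (fun y hy => by simp [hy])]
  simp

theorem expect_map (π : PMF S) (g : S → T) (f : T → ℝ≥0∞) :
    expect (π.map g) f = expect π fun x => f (g x) := by
  rw [PMF.map, expect_bind]
  simp only [Function.comp_apply, expect_pure]

theorem expect_add (π : PMF S) (f g : S → ℝ≥0∞) :
    expect π (fun x => f x + g x) = expect π f + expect π g := by
  simp only [expect, mul_add, ENNReal.tsum_add]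

theorem expect_mono (π : PMF S) {f g : S → ℝ≥0∞} (h : ∀ x, f x ≤ g x) :
    expect π f ≤ expect π g :=
  ENNReal.tsum_le_tsum fun x => mul_le_mul_right (h x) _

theorem expect_const (π : PMF S) (c : ℝ≥0∞) : expect π (fun _ => c) = c := by
  rw [expect, ENNReal.tsum_mul_right, π.tsum_coe, one_mul]

theorem expect_const_mul (π : PMF S) (c : ℝ≥0∞) (f : S → ℝ≥0∞) :
    expect π (fun x => c * f x) = c * expect π f := by
  simp only [expect, ← ENNReal.tsum_mul_left, mul_left_comm]

theorem expect_tsum (π : PMF S) (f : ℕ → S → ℝ≥0∞) :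
    expect π (fun x => ∑' n, f n x) = ∑' n, expect π (f n) := by
  simp only [expect, ← ENNReal.tsum_mul_left]
  rw [ENNReal.tsum_comm]

theorem expect_le_one (π : PMF S) {f : S → ℝ≥0∞} (h : ∀ x, f x ≤ 1) : expect π f ≤ 1 :=
  (expect_mono π h).trans (expect_const π 1).le

theorem mul_le_expect (π : PMF S) (f : S → ℝ≥0∞) (x : S) : π x * f x ≤ expect π f :=
  ENNReal.le_tsum x

theorem apply_eq_expect [DecidableEq S] (π : PMF S) (x : S) : π x = expect π fun y => if y = x then 1 else 0 := by
  rw [expect, tsum_eq_single x (fun y hy => by simp [hy])]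
  simp

/-- A nonzero invariant measure of finite mass can be normalized. -/
theorem exists_isStationary_of_invariant {κ : S → PMF S} {m : S → ℝ≥0∞}
    (h0 : ∑' x, m x ≠ 0) (htop : ∑' x, m x ≠ ∞) (h : ∀ z, ∑' y, m y * κ y z = m z) :
    ∃ π, IsStationary κ π := by
  refine ⟨PMF.normalize m h0 htop, PMF.ext fun z => ?_⟩
  simp only [PMF.bind_apply, PMF.normalize_apply]
  rw [← h z, ← ENNReal.tsum_mul_right]
  exact tsum_congr fun y => by ring

open Classical in
theorem avoidProb_succ (κ : S → PMF S) (x : S) (n : ℕ) (y : S) :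
    avoidProb κ x (n + 1) y = expect (κ y) fun z => if z = x then 0 else avoidProb κ x n z := rfl

open Classical in
/-- The probability that the chain started in `x` is in `y` at time `n` and has not returned to `x`
by then. -/
noncomputable def excursion (κ : S → PMF S) (x : S) : ℕ → S → ℝ≥0∞
  | 0, y => if y = x then 1 else 0
  | n + 1, z => if z = x then 0 else ∑' y, excursion κ x n y * κ y z

/-- Adjointness: one step of the kernel killed at `x` moves from the forward measure to the backward
function. -/
theorem tsum_excursion_succ_mul (κ : S → PMF S) (x : S) (n m : ℕ) :
    ∑' z, excursion κ x (n + 1) z * avoidProb κ x m z =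
      ∑' y, excursion κ x n y * avoidProb κ x (m + 1) y := by
  simp only [avoidProb_succ, expect, ← ENNReal.tsum_mul_left]
  rw [ENNReal.tsum_comm]
  refine tsum_congr fun z => ?_
  by_cases hz : z = x
  · simp [hz, excursion]
  · simp only [excursion, hz, if_false, ← ENNReal.tsum_mul_right, mul_assoc]

theorem tsum_excursion (κ : S → PMF S) (x : S) (n : ℕ) :
    ∑' y, excursion κ x n y = avoidProb κ x n x := by
  -- Running `n` killed steps forward and `m` backward always gives the probability of no return
  -- during `n + m` steps; `m = 0` is the claim.
  have key : ∀ n m, ∑' z, excursion κ x n z * avoidProb κ x m z = avoidProb κ x (n + m) x := by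
    intro n
    induction n with
    | zero =>
      intro m
      rw [tsum_eq_single x (fun y hy => by simp [hy, excursion])]
      simp [excursion]
    | succ n ih =>
      intro m
      rw [tsum_excursion_succ_mul, ih, Nat.add_right_comm, Nat.add_assoc]
  simpa [avoidProb] using key n 0

/-- A chain with a positive recurrent state has a stationary distribution. -/
theorem IsPositiveRecurrent.exists_isStationary {κ : S → PMF S} {x : S}
    (h : IsPositiveRecurrent κ x) : ∃ π, IsStationary κ π := by
  classical
  set m : S → ℝ≥0∞ := fun y => ∑' n, excursion κ x n y with hm
  have hmass : ∑' y, m y = meanReturnTime κ x := by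
    rw [hm, ENNReal.tsum_comm]
    simp only [tsum_excursion, meanReturnTime]
  have htop : ∑' y, m y ≠ ∞ := hmass ▸ h.ne
  have h0 : ∑' y, m y ≠ 0 := by
    rw [hmass]
    have : avoidProb κ x 0 x ≤ meanReturnTime κ x := ENNReal.le_tsum 0
    rw [avoidProb] at this
    exact (zero_lt_one.trans_le this).ne'
  -- Away from `x` the time-0 term of the excursion vanishes, so applying the kernel is just a shift
  -- of time.
  have hne : ∀ z, z ≠ x → ∑' y, m y * κ y z = m z := by
    intro z hz
    simp only [hm, ← ENNReal.tsum_mul_right]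
    rw [ENNReal.tsum_comm, tsum_eq_zero_add' (f := fun n => excursion κ x n z) ENNReal.summable]
    simp only [excursion, hz, if_false, zero_add]
  refine exists_isStationary_of_invariant h0 htop fun z => ?_
  by_cases hz : z = x
  swap
  · exact hne z hz
  subst hz
  -- The kernel preserves total mass. As that mass is finite, invariance away from `x` can be
  -- cancelled to give invariance at `x`.
  have htot : ∑' u, ∑' y, m y * κ y u = ∑' u, m u := by
    rw [ENNReal.tsum_comm]
    simp only [ENNReal.tsum_mul_left, PMF.tsum_coe, mul_one]
  rw [ENNReal.tsum_eq_add_tsum_ite z, ENNReal.tsum_eq_add_tsum_ite (f := m) z] at htot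
  have hrest : ∑' u, (if u = z then 0 else ∑' y, m y * κ y u) =
      ∑' u, (if u = z then 0 else m u) := by
    refine tsum_congr fun u => ?_
    split_ifs with hu
    · rfl
    · exact hne u hu
  rw [hrest] at htot
  refine (ENNReal.add_left_inj (ne_top_of_le_ne_top htop ?_)).1 htot
  exact ENNReal.tsum_le_tsum fun u => by split_ifs <;> simp

/-- Decomposition at the last visit to `x`. -/
theorem sum_antidiagonal_apply_mul_avoidProb_le_one {κ : S → PMF S} {ν : ℕ → PMF S}
    (hν : ∀ n, ν (n + 1) = (ν n).bind κ) (x : S) (n : ℕ) :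
    ∑ ij ∈ Finset.HasAntidiagonal.antidiagonal n, ν (ij.1 + 1) x * avoidProb κ x ij.2 x ≤ 1 := by
  classical
  have step : ∀ j n, expect (ν (j + 1)) (avoidProb κ x n) =
      expect (ν j) (avoidProb κ x (n + 1)) + ν (j + 1) x * avoidProb κ x n x := by
    intro j n
    have : ∀ y, avoidProb κ x n y = (if y = x then 0 else avoidProb κ x n y) +
        avoidProb κ x n x * (if y = x then 1 else 0) := by
      intro y; split_ifs with hy <;> simp [hy]
    rw [show avoidProb κ x n = _ from funext this, expect_add, expect_const_mul, ← apply_eq_expect,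
      hν j, expect_bind]
    simp only [← avoidProb_succ, mul_comm]
    simp
  -- The spare horizon `m` is what makes the induction on `n` close: each step turns one unit of
  -- time into one unit of horizon.
  have key : ∀ n m, expect (ν 0) (avoidProb κ x (n + 1 + m)) +
      ∑ ij ∈ Finset.HasAntidiagonal.antidiagonal n, ν (ij.1 + 1) x * avoidProb κ x (ij.2 + m) x =
        expect (ν (n + 1)) (avoidProb κ x m) := by
    intro n
    induction n with
    | zero => intro m; simp [step, Nat.add_comm]
    | succ n ih =>
      intro m
      rw [Finset.Nat.antidiagonal_succ', Finset.sum_cons, Finset.sum_map, step (n + 1), ← ih (m + 1)]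
      simp only [Function.Embedding.prodMap, Function.Embedding.coeFn_mk, Prod.map,
        Function.Embedding.refl_apply, Nat.succ_eq_add_one, Nat.zero_add]
      rw [show n + 1 + 1 + m = n + 1 + (m + 1) by omega]
      simp only [Nat.add_assoc, Nat.add_comm 1 m]
      ring
  have h := key n 0
  simp only [Nat.add_zero, avoidProb] at h
  rw [expect_const] at h
  exact h ▸ le_add_self

/-- A state that is visited with a positive asymptotic frequency is positive recurrent. -/
theorem isPositiveRecurrent_of_frequency {κ : S → PMF S} {ν : ℕ → PMF S}
    (hν : ∀ n, ν (n + 1) = (ν n).bind κ) {x : S} {c : ℝ≥0∞} (hc : c ≠ 0) (hc' : c ≠ ∞)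
    (h : ∀ n : ℕ, c * n ≤ ∑ i ∈ Finset.range n, ν (i + 1) x) : IsPositiveRecurrent κ x := by
  have hbound : ∀ n, ∑ j ∈ Finset.range n, avoidProb κ x j x ≤ 2 / c := by
    intro n
    rcases Nat.eq_zero_or_pos n with rfl | hn
    · simp
    -- The square of index pairs is covered by the antidiagonals below `2 * n`, each of sum at most
    -- 1. With the frequency bound this leaves `2 / c`.
    have h1 : (∑ i ∈ Finset.range n, ν (i + 1) x) * ∑ j ∈ Finset.range n, avoidProb κ x j x ≤
        ((2 * n : ℕ) : ℝ≥0∞) := by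
      rw [Finset.sum_mul_sum, ← Finset.sum_product']
      calc _ ≤ ∑ ij ∈ (Finset.range (2 * n)).biUnion Finset.HasAntidiagonal.antidiagonal,
            ν (ij.1 + 1) x * avoidProb κ x ij.2 x := by
            refine Finset.sum_le_sum_of_subset fun ij hij => ?_
            simp only [Finset.mem_product, Finset.mem_range, Finset.mem_biUnion,
              Finset.HasAntidiagonal.mem_antidiagonal] at hij ⊢
            exact ⟨_, by omega, rfl⟩
        _ = ∑ k ∈ Finset.range (2 * n), ∑ ij ∈ Finset.HasAntidiagonal.antidiagonal k,
            ν (ij.1 + 1) x * avoidProb κ x ij.2 x := by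
            refine Finset.sum_biUnion fun a _ b _ hab => ?_
            exact Finset.disjoint_left.2 fun ij ha hb => hab (by
              rw [Finset.HasAntidiagonal.mem_antidiagonal] at ha hb; omega)
        _ ≤ ∑ k ∈ Finset.range (2 * n), 1 :=
            Finset.sum_le_sum fun k _ => sum_antidiagonal_apply_mul_avoidProb_le_one hν x k
        _ = _ := by simp
    have hn0 : (n : ℝ≥0∞) ≠ 0 := by exact_mod_cast hn.ne'
    have h2 := (mul_le_mul_left (h n) _).trans h1
    rw [ENNReal.le_div_iff_mul_le (Or.inl hc) (Or.inl hc')]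
    refine (ENNReal.mul_le_mul_iff_left hn0 (ENNReal.natCast_ne_top n)).1 ?_
    push_cast at h2
    calc _ = _ := by ring
      _ ≤ _ := h2
  refine lt_of_le_of_lt (ENNReal.tsum_le_of_sum_range_le hbound) ?_
  exact ENNReal.div_lt_top (by simp) hc

/-- A state that is charged by a stationary distribution is positive recurrent. -/
theorem IsStationary.isPositiveRecurrent {κ : S → PMF S} {π : PMF S} (h : IsStationary κ π)
    {x : S} (hx : π x ≠ 0) : IsPositiveRecurrent κ x :=
  isPositiveRecurrent_of_frequency (ν := fun _ => π) (fun _ => h.symm) hx (π.apply_ne_top x)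
    fun n => by simp [mul_comm]

end MarkovChain

/-! ### The law of one slot. -/

section Slot

variable {S : Type*}

theorem expect_coin (p : unitInterval) (f : Bool → ℝ≥0∞) :
    expect (coin p) f = ENNReal.ofReal p * f true + ENNReal.ofReal (1 - p) * f false := by
  rw [expect, tsum_fintype, Fintype.sum_bool]
  simp [coin]

/-- The probability that a coin shows `b`. -/
def coinProb (p : unitInterval) (b : Bool) : ℝ := if b then p else 1 - p

theorem coinProb_nonneg (p : unitInterval) (b : Bool) : 0 ≤ coinProb p b := by
  unfold coinProb
  split_ifs
  exacts [p.2.1, sub_nonneg.2 p.2.2]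

theorem coin_apply (p : unitInterval) (b : Bool) : coin p b = ENNReal.ofReal (coinProb p b) := rfl

theorem expect_slotLaw (l₁ l₂ p₁ p₂ : unitInterval) (f : Slot → ℝ≥0∞) :
    expect (slotLaw l₁ l₂ p₁ p₂) f =
      ∑ a₁, ∑ a₂, ∑ t₁, ∑ t₂, ENNReal.ofReal (coinProb l₁ a₁ * coinProb l₂ a₂ * coinProb p₁ t₁ *
        coinProb p₂ t₂) * f ⟨a₁, a₂, t₁, t₂⟩ := by
  simp only [slotLaw, expect_bind, expect_map]
  simp only [expect, tsum_fintype, Finset.mul_sum, coin_apply, ← mul_assoc]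
  refine Finset.sum_congr rfl fun a₁ _ => Finset.sum_congr rfl fun a₂ _ =>
    Finset.sum_congr rfl fun t₁ _ => Finset.sum_congr rfl fun t₂ _ => ?_
  have h1 := coinProb_nonneg l₁ a₁
  have h2 := coinProb_nonneg l₂ a₂
  have h3 := coinProb_nonneg p₁ t₁
  rw [ENNReal.ofReal_mul (by positivity), ENNReal.ofReal_mul (by positivity),
    ENNReal.ofReal_mul h1]

theorem toReal_expect_slotLaw (l₁ l₂ p₁ p₂ : unitInterval) (P : Slot → Prop) [∀ w, Decidable (P w)] :
    (expect (slotLaw l₁ l₂ p₁ p₂) fun w => if P w then 1 else 0).toReal =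
      ∑ a₁, ∑ a₂, ∑ t₁, ∑ t₂, coinProb l₁ a₁ * coinProb l₂ a₂ * coinProb p₁ t₁ *
        coinProb p₂ t₂ * if P ⟨a₁, a₂, t₁, t₂⟩ then 1 else 0 := by
  rw [expect_slotLaw]
  have hn : ∀ a₁ a₂ t₁ t₂, 0 ≤ coinProb l₁ a₁ * coinProb l₂ a₂ * coinProb p₁ t₁ *
        coinProb p₂ t₂ := fun a₁ a₂ t₁ t₂ => mul_nonneg (mul_nonneg (mul_nonneg
      (coinProb_nonneg _ _) (coinProb_nonneg _ _)) (coinProb_nonneg _ _)) (coinProb_nonneg _ _)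
  have ht : ∀ (x : ℝ) (Q : Prop) [Decidable Q],
      ENNReal.ofReal x * (if Q then 1 else 0) ≠ ∞ := by
    intro x Q _
    split_ifs <;> simp
  simp only [ENNReal.toReal_sum, ENNReal.sum_ne_top, ht, ne_eq, not_false_eq_true, implies_true,
    ENNReal.toReal_mul, ENNReal.toReal_ofReal (hn _ _ _ _),
    apply_ite ENNReal.toReal, ENNReal.toReal_one, ENNReal.toReal_zero]

/-- This outcome drives every emptying argument below. The access coins must show `true` because
`p₁` and `p₂` may equal 1. -/
theorem slotLaw_apply_pos {l₁ l₂ p₁ p₂ : unitInterval} (hl₁ : l₁ < 1) (hl₂ : l₂ < 1)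
    (hp₁ : 0 < p₁) (hp₂ : 0 < p₂) : slotLaw l₁ l₂ p₁ p₂ ⟨false, false, true, true⟩ ≠ 0 := by
  have h1 : (0 : ℝ) < 1 - l₁ := sub_pos.2 hl₁
  have h2 : (0 : ℝ) < 1 - l₂ := sub_pos.2 hl₂
  have h3 : (0 : ℝ) < p₁ := hp₁
  have h4 : (0 : ℝ) < p₂ := hp₂
  have h : (slotLaw l₁ l₂ p₁ p₂ ⟨false, false, true, true⟩).toReal =
      (1 - l₁) * (1 - l₂) * p₁ * p₂ := by
    rw [apply_eq_expect]
    convert toReal_expect_slotLaw l₁ l₂ p₁ p₂ (fun w => w = ⟨false, false, true, true⟩)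
    simp [coinProb]
  intro h0
  rw [h0, ENNReal.toReal_zero] at h
  exact (by positivity : 0 < (1 - (l₁ : ℝ)) * (1 - l₂) * p₁ * p₂).ne h

end Slot

/-! ### Transition probabilities of queue 1. -/

section Queue1

variable (l₁ l₂ p₁ p₂ : unitInterval)

theorem toReal_queue1Chain (s z : Queue1State) :
    (queue1Chain l₁ l₂ p₁ p₂ s z).toReal =
      ∑ a₁, ∑ a₂, ∑ t₁, ∑ t₂, coinProb l₁ a₁ * coinProb l₂ a₂ * coinProb p₁ t₁ *
        coinProb p₂ t₂ * if next1 s ⟨a₁, a₂, t₁, t₂⟩ = z then 1 else 0 := by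
  rw [apply_eq_expect, queue1Chain, expect_map]
  convert toReal_expect_slotLaw l₁ l₂ p₁ p₂ (fun w => next1 s w = z)

variable (n m : ℕ)

theorem toReal_queue1Chain_first_first :
    (queue1Chain l₁ l₂ p₁ p₂ (m, .first) (n, .first)).toReal =
      (l₁ * p₁ * (1 - p₂) + (1 - l₁) * (1 - p₁)) * (if m = n then 1 else 0) +
      (1 - l₁) * p₁ * (1 - p₂) * (if m = n + 1 then 1 else 0) +
      l₁ * (1 - p₁) * (if m + 1 = n then 1 else 0) +
      (1 - l₁) * p₁ * (if m = 0 ∧ n = 0 then 1 else 0) := by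
  rw [toReal_queue1Chain]
  simp only [Fintype.sum_bool]
  rcases m with _ | m <;> simp [next1, sends1, sends2, backlog1, coinProb] <;>
    split_ifs <;> first | omega | ring

theorem toReal_queue1Chain_retrans_first :
    (queue1Chain l₁ l₂ p₁ p₂ (m, .retrans) (n, .first)).toReal =
      l₁ * (if m = n then 1 else 0) + (1 - l₁) * (if m = n + 1 then 1 else 0) +
      (1 - l₁) * (if m = 0 ∧ n = 0 then 1 else 0) := by
  rw [toReal_queue1Chain]
  simp only [Fintype.sum_bool]
  rcases m with _ | m <;> simp [next1, sends1, sends2, backlog1, coinProb] <;>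
    split_ifs <;> first | omega | ring

theorem toReal_queue1Chain_first_retrans :
    (queue1Chain l₁ l₂ p₁ p₂ (m, .first) (n, .retrans)).toReal =
      p₁ * p₂ * (l₁ * (if m + 1 = n then 1 else 0) +
        (1 - l₁) * (if m = n ∧ n ≠ 0 then 1 else 0)) := by
  rw [toReal_queue1Chain]
  simp only [Fintype.sum_bool]
  rcases m with _ | m <;> simp [next1, sends1, sends2, backlog1, coinProb] <;>
    split_ifs <;> first | omega | ring

theorem toReal_queue1Chain_retrans_retrans :
    (queue1Chain l₁ l₂ p₁ p₂ (m, .retrans) (n, .retrans)).toReal = 0 := by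
  rw [toReal_queue1Chain]
  simp only [Fintype.sum_bool]
  rcases m with _ | m <;> simp [next1, sends1, sends2, backlog1, coinProb]

end Queue1

/-! ### Balance equations and the stationary distribution of queue 1. -/

section Queue1

variable (l₁ l₂ p₁ p₂ : unitInterval) {m : Queue1State → ℝ≥0∞}

/-- Each state has finitely many predecessors, so balance equations become finite real identities
open to linear arithmetic. -/
theorem toReal_tsum_mul_queue1Chain (hm : ∀ s, m s ≠ ∞) (z : Queue1State) (s : Finset Queue1State)
    (h : ∀ y ∉ s, (queue1Chain l₁ l₂ p₁ p₂ y z).toReal = 0) :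
    (∑' y, m y * queue1Chain l₁ l₂ p₁ p₂ y z).toReal =
      ∑ y ∈ s, (m y).toReal * (queue1Chain l₁ l₂ p₁ p₂ y z).toReal := by
  have htop : ∀ y, queue1Chain l₁ l₂ p₁ p₂ y z ≠ ∞ := fun y => PMF.apply_ne_top _ _
  rw [tsum_eq_sum (s := s), ENNReal.toReal_sum]
  · simp only [ENNReal.toReal_mul]
  · exact fun y _ => ENNReal.mul_ne_top (hm y) (htop y)
  · intro y hy
    rw [((ENNReal.toReal_eq_zero_iff _).1 (h y hy)).resolve_right (htop y), mul_zero]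

theorem balance_zero_first (hm : ∀ s, m s ≠ ∞) :
    (∑' y, m y * queue1Chain l₁ l₂ p₁ p₂ y (0, .first)).toReal =
      (l₁ * p₁ * (1 - p₂) + (1 - l₁)) * (m (0, .first)).toReal +
      (1 - l₁) * p₁ * (1 - p₂) * (m (1, .first)).toReal +
      (m (0, .retrans)).toReal + (1 - l₁) * (m (1, .retrans)).toReal := by
  rw [toReal_tsum_mul_queue1Chain l₁ l₂ p₁ p₂ hm _
    {(0, .first), (1, .first), (0, .retrans), (1, .retrans)}]
  · simp [toReal_queue1Chain_first_first, toReal_queue1Chain_retrans_first]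
    ring
  · rintro ⟨k, _ | _⟩ hk <;> simp at hk <;>
      simp [toReal_queue1Chain_first_first, toReal_queue1Chain_retrans_first, hk]

theorem balance_succ_first (hm : ∀ s, m s ≠ ∞) (n : ℕ) :
    (∑' y, m y * queue1Chain l₁ l₂ p₁ p₂ y (n + 1, .first)).toReal =
      l₁ * (1 - p₁) * (m (n, .first)).toReal +
      (l₁ * p₁ * (1 - p₂) + (1 - l₁) * (1 - p₁)) * (m (n + 1, .first)).toReal +
      (1 - l₁) * p₁ * (1 - p₂) * (m (n + 2, .first)).toReal +
      l₁ * (m (n + 1, .retrans)).toReal + (1 - l₁) * (m (n + 2, .retrans)).toReal := by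
  rw [toReal_tsum_mul_queue1Chain l₁ l₂ p₁ p₂ hm _
    {(n, .first), (n + 1, .first), (n + 2, .first), (n + 1, .retrans), (n + 2, .retrans)}]
  · simp [toReal_queue1Chain_first_first, toReal_queue1Chain_retrans_first,
      show n ≠ n + 1 + 1 by omega]
    ring
  · rintro ⟨k, _ | _⟩ hk <;> simp at hk <;>
      simp [toReal_queue1Chain_first_first, toReal_queue1Chain_retrans_first, hk]

theorem balance_zero_retrans (hm : ∀ s, m s ≠ ∞) :
    (∑' y, m y * queue1Chain l₁ l₂ p₁ p₂ y (0, .retrans)).toReal = 0 := by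
  rw [toReal_tsum_mul_queue1Chain l₁ l₂ p₁ p₂ hm _ ∅]
  · simp
  · rintro ⟨k, _ | _⟩ - <;>
      simp [toReal_queue1Chain_first_retrans, toReal_queue1Chain_retrans_retrans]

theorem balance_succ_retrans (hm : ∀ s, m s ≠ ∞) (n : ℕ) :
    (∑' y, m y * queue1Chain l₁ l₂ p₁ p₂ y (n + 1, .retrans)).toReal =
      p₁ * p₂ * (l₁ * (m (n, .first)).toReal + (1 - l₁) * (m (n + 1, .first)).toReal) := by
  rw [toReal_tsum_mul_queue1Chain l₁ l₂ p₁ p₂ hm _ {(n, .first), (n + 1, .first)}]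
  · simp [toReal_queue1Chain_first_retrans]
    ring
  · rintro ⟨k, _ | _⟩ hk <;> simp at hk <;>
      simp [toReal_queue1Chain_first_retrans, toReal_queue1Chain_retrans_retrans, hk]

instance : Fintype Phase := ⟨{.first, .retrans}, by rintro ⟨⟩ <;> simp⟩

theorem tsum_queue1State (g : Queue1State → ℝ≥0∞) :
    ∑' s, g s = ∑' n, g (n, .first) + ∑' n, g (n, .retrans) := by
  have h : ∀ f : Phase → ℝ≥0∞, ∑' b, f b = f .first + f .retrans := fun f => by
    rw [tsum_fintype]
    exact Finset.sum_pair (by simp)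
  rw [ENNReal.tsum_prod (f := fun n b => g (n, b))]
  simp only [h, ENNReal.tsum_add]

variable {l₁ l₂ p₁ p₂} {π : PMF Queue1State}

theorem IsStationary.toReal_balance (h : IsStationary (queue1Chain l₁ l₂ p₁ p₂) π)
    (z : Queue1State) :
    (π z).toReal = (∑' y, π y * queue1Chain l₁ l₂ p₁ p₂ y z).toReal := by
  rw [← PMF.bind_apply, h]

theorem IsStationary.toReal_zero_retrans (h : IsStationary (queue1Chain l₁ l₂ p₁ p₂) π) :
    (π (0, .retrans)).toReal = 0 := by
  rw [h.toReal_balance, balance_zero_retrans _ _ _ _ π.apply_ne_top]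

theorem IsStationary.toReal_succ_retrans (h : IsStationary (queue1Chain l₁ l₂ p₁ p₂) π) (n : ℕ) :
    (π (n + 1, .retrans)).toReal =
      p₁ * p₂ * (l₁ * (π (n, .first)).toReal + (1 - l₁) * (π (n + 1, .first)).toReal) := by
  rw [h.toReal_balance, balance_succ_retrans _ _ _ _ π.apply_ne_top]

/-- The flow of queue 1 from `n` to `n + 1` packets equals the flow back. -/
theorem IsStationary.cut (h : IsStationary (queue1Chain l₁ l₂ p₁ p₂) π) (n : ℕ) :
    l₁ * (1 - p₁ + p₁ * p₂) * (π (n, .first)).toReal =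
      (1 - l₁) * (p₁ * (1 - p₂) * (π (n + 1, .first)).toReal +
        (π (n + 1, .retrans)).toReal) := by
  induction n with
  | zero =>
    have h0 := h.toReal_balance (0, .first)
    rw [balance_zero_first _ _ _ _ π.apply_ne_top, h.toReal_zero_retrans] at h0
    linear_combination h0
  | succ n ih =>
    have h0 := h.toReal_balance (n + 1, .first)
    rw [balance_succ_first _ _ _ _ π.apply_ne_top] at h0
    have h1 := h.toReal_succ_retrans n
    -- Adding the balance equations of both states of length `n + 1` moves the cut up by one.
    linear_combination ih + h0 + h1

/-- The `retrans` mass in the cut equation is itself a combination of two `first` masses;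
substituting it leaves only phase `first`. -/
theorem IsStationary.toReal_first_recurrence (h : IsStationary (queue1Chain l₁ l₂ p₁ p₂) π)
    (n : ℕ) :
    p₁ * (1 - l₁) * (1 - l₁ * p₂) * (π (n + 1, .first)).toReal =
      l₁ * (1 - p₁ + l₁ * p₁ * p₂) * (π (n, .first)).toReal := by
  linear_combination (-1) * h.cut n - (1 - (l₁ : ℝ)) * h.toReal_succ_retrans n

theorem one_sub_mul_pos (hl : l₁ < 1) : (0 : ℝ) < 1 - l₁ * p₂ := by
  have h1 : (l₁ : ℝ) < 1 := hl
  nlinarith [p₂.2.2, l₁.2.1]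

theorem summable_toReal_and_tsum_eq_one (π : PMF Queue1State) :
    Summable (fun n => (π (n, .first)).toReal) ∧
    Summable (fun n => (π (n, .retrans)).toReal) ∧
    ∑' n, (π (n, .first)).toReal + ∑' n, (π (n, .retrans)).toReal = 1 := by
  have h := π.tsum_coe
  rw [tsum_queue1State] at h
  have h1 : ∑' n, π (n, .first) ≠ ∞ := fun h' => by simp [h'] at h
  have h2 : ∑' n, π (n, .retrans) ≠ ∞ := fun h' => by simp [h'] at h
  refine ⟨ENNReal.summable_toReal h1, ENNReal.summable_toReal h2, ?_⟩
  rw [← ENNReal.tsum_toReal_eq fun _ => π.apply_ne_top _,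
    ← ENNReal.tsum_toReal_eq fun _ => π.apply_ne_top _, ← ENNReal.toReal_add h1 h2, h,
    ENNReal.toReal_one]

theorem ratio_nonneg (hl : l₁ < 1) : 0 ≤ ratio l₁ p₁ p₂ := by
  have h1 : (0 : ℝ) < 1 - l₁ := sub_pos.2 hl
  have h2 : (0 : ℝ) ≤ 1 - p₁ := sub_nonneg.2 p₁.2.2
  have h3 := one_sub_mul_pos (p₂ := p₂) hl
  have := l₁.2.1
  have := p₁.2.1
  have := p₂.2.1
  unfold ratio
  positivity

theorem ratio_lt_one_iff (hl : l₁ < 1) (hp : 0 < p₁) :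
    ratio l₁ p₁ p₂ < 1 ↔ (l₁ : ℝ) < p₁ / (1 + p₁ * p₂) := by
  have h1 : (0 : ℝ) < 1 - l₁ := sub_pos.2 hl
  have h2 : (0 : ℝ) < p₁ := hp
  have h3 := one_sub_mul_pos (p₂ := p₂) hl
  have := p₂.2.1
  rw [ratio, div_lt_one (by positivity), lt_div_iff₀ (by positivity)]
  constructor <;> intro h <;> linarith

/-- The structure of a stationary distribution of queue 1. -/
theorem IsStationary.geometric (h : IsStationary (queue1Chain l₁ l₂ p₁ p₂) π)
    (hl : 0 < l₁ ∧ l₁ < 1) :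
    0 < p₁ ∧ ratio l₁ p₁ p₂ < 1 ∧
    (π (0, .first)).toReal = (1 - ratio l₁ p₁ p₂) * (1 - l₁ * p₂) ∧
    (∀ k, (π (k, .first)).toReal = ratio l₁ p₁ p₂ ^ k * (π (0, .first)).toReal) ∧
    (∀ k, (π (k + 1, .retrans)).toReal =
      ratio l₁ p₁ p₂ ^ k * (l₁ * p₂ / (1 - l₁ * p₂)) * (π (0, .first)).toReal) ∧
    ∑' n, (π (n, .first)).toReal = 1 - l₁ * p₂ := by
  have hl0 : (0 : ℝ) < l₁ := hl.1
  have h1 : (0 : ℝ) < 1 - l₁ := sub_pos.2 hl.2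
  have h3 := one_sub_mul_pos (p₂ := p₂) hl.2
  obtain ⟨hsF, hsR, hsum⟩ := summable_toReal_and_tsum_eq_one π
  -- With `p₁ = 0` the ratio would be 0 by division by zero, so this case is excluded first: the
  -- recurrence would kill all the mass.
  have hp : 0 < p₁ := by
    rcases p₁.2.1.lt_or_eq with hp | hp
    · exact hp
    · have hf : ∀ n, (π (n, .first)).toReal = 0 := fun n => by
        have := h.toReal_first_recurrence n
        rw [← hp] at this
        simpa [hl0.ne'] using this
      have hr : ∀ n, (π (n, .retrans)).toReal = 0
        | 0 => h.toReal_zero_retrans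
        | n + 1 => by rw [h.toReal_succ_retrans, ← hp]; simp
      simp [hf, hr] at hsum
  have hp' : (0 : ℝ) < p₁ := hp
  have hrec : ∀ n, (π (n + 1, .first)).toReal = ratio l₁ p₁ p₂ * (π (n, .first)).toReal := by
    intro n
    have := h.toReal_first_recurrence n
    rw [ratio]
    field_simp
    linear_combination this
  have hgeo : ∀ k, (π (k, .first)).toReal = ratio l₁ p₁ p₂ ^ k * (π (0, .first)).toReal := by
    intro k
    induction k with
    | zero => simp
    | succ k ih => rw [hrec, ih]; ring
  have hret : ∀ k, (π (k + 1, .retrans)).toReal =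
      ratio l₁ p₁ p₂ ^ k * (l₁ * p₂ / (1 - l₁ * p₂)) * (π (0, .first)).toReal := by
    intro k
    have key : p₁ * p₂ * (l₁ + (1 - l₁) * ratio l₁ p₁ p₂) = l₁ * p₂ / (1 - l₁ * p₂) := by
      have hρ : ratio l₁ p₁ p₂ * (p₁ * (1 - l₁) * (1 - l₁ * p₂)) =
          l₁ * (1 - p₁ + l₁ * p₁ * p₂) := by
        rw [ratio]
        field_simp
      rw [eq_div_iff h3.ne']
      linear_combination (p₂ : ℝ) * hρ
    rw [h.toReal_succ_retrans, hrec, hgeo, ← key]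
    ring
  have hpos : (π (0, .first)).toReal ≠ 0 := by
    intro h0
    have hf : ∀ n, (π (n, .first)).toReal = 0 := fun n => by rw [hgeo, h0, mul_zero]
    have hr : ∀ n, (π (n, .retrans)).toReal = 0
      | 0 => h.toReal_zero_retrans
      | n + 1 => by rw [hret, h0, mul_zero]
    simp [hf, hr] at hsum
  have hlt : ratio l₁ p₁ p₂ < 1 := by
    have hs : Summable fun k => ratio l₁ p₁ p₂ ^ k := by
      refine (summable_mul_right_iff hpos).1 ?_
      simpa only [← hgeo] using hsF
    have := summable_geometric_iff_norm_lt_one.1 hs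
    rwa [Real.norm_of_nonneg (ratio_nonneg hl.2)] at this
  have hF : ∑' n, (π (n, .first)).toReal =
      (1 - ratio l₁ p₁ p₂)⁻¹ * (π (0, .first)).toReal := by
    rw [tsum_congr hgeo, tsum_mul_right, tsum_geometric_of_lt_one (ratio_nonneg hl.2) hlt]
  have hR : ∑' n, (π (n, .retrans)).toReal =
      (1 - ratio l₁ p₁ p₂)⁻¹ * (l₁ * p₂ / (1 - l₁ * p₂)) * (π (0, .first)).toReal := by
    rw [hsR.tsum_eq_zero_add, h.toReal_zero_retrans, zero_add, tsum_congr hret, tsum_mul_right,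
      tsum_mul_right, tsum_geometric_of_lt_one (ratio_nonneg hl.2) hlt]
  have h4 : 0 < 1 - ratio l₁ p₁ p₂ := sub_pos.2 hlt
  have h0 : (π (0, .first)).toReal = (1 - ratio l₁ p₁ p₂) * (1 - l₁ * p₂) := by
    rw [hF, hR] at hsum
    field_simp at hsum
    linarith
  refine ⟨hp, hlt, h0, hgeo, hret, ?_⟩
  rw [hF, h0]
  field_simp

theorem toReal_zero_first_formula (hl : l₁ < 1) (hp : 0 < p₁) :
    (1 - ratio l₁ p₁ p₂) * (1 - l₁ * p₂) =
      (p₁ - l₁ * (1 + p₁ * p₂)) / (p₁ * (1 - l₁)) := by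
  have h1 : (0 : ℝ) < 1 - l₁ := sub_pos.2 hl
  have h2 : (0 : ℝ) < p₁ := hp
  have h3 := one_sub_mul_pos (p₂ := p₂) hl
  rw [ratio]
  field_simp
  ring

theorem IsStationary.unique (hl : 0 < l₁ ∧ l₁ < 1) {π' : PMF Queue1State}
    (h : IsStationary (queue1Chain l₁ l₂ p₁ p₂) π)
    (h' : IsStationary (queue1Chain l₁ l₂ p₁ p₂) π') : π = π' := by
  obtain ⟨-, -, h0, hF, hR, -⟩ := h.geometric hl
  obtain ⟨-, -, h0', hF', hR', -⟩ := h'.geometric hl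
  refine PMF.ext fun ⟨k, b⟩ =>
    (ENNReal.toReal_eq_toReal_iff' (π.apply_ne_top _) (π'.apply_ne_top _)).1 ?_
  cases b with
  | first => rw [hF, hF', h0, h0']
  | retrans =>
    cases k with
    | zero => rw [h.toReal_zero_retrans, h'.toReal_zero_retrans]
    | succ k => rw [hR, hR', h0, h0']

/-- The geometric weights, scaled to mass 1 at the empty `first` state, are summable and satisfy
every balance equation; normalizing them suffices. -/
theorem exists_isStationary_queue1Chain (hl : 0 < l₁ ∧ l₁ < 1)
    (hlt : (l₁ : ℝ) < p₁ / (1 + p₁ * p₂)) :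
    ∃ π, IsStationary (queue1Chain l₁ l₂ p₁ p₂) π := by
  have hl0 : (0 : ℝ) < l₁ := hl.1
  have h1 : (0 : ℝ) < 1 - l₁ := sub_pos.2 hl.2
  have h3 := one_sub_mul_pos (p₂ := p₂) hl.2
  have hp : 0 < p₁ := by
    rcases p₁.2.1.lt_or_eq with hp | hp
    · exact hp
    · rw [← hp, zero_div] at hlt
      exact absurd hlt hl0.not_gt
  have hp' : (0 : ℝ) < p₁ := hp
  have hp2 := p₂.2.1
  have hρ0 := ratio_nonneg (p₁ := p₁) (p₂ := p₂) hl.2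
  have hρ := (ratio_lt_one_iff (p₂ := p₂) hl.2 hp).2 hlt
  have hgeo : ∑' n : ℕ, ENNReal.ofReal (ratio l₁ p₁ p₂ ^ n) ≠ ∞ :=
    (summable_geometric_of_lt_one hρ0 hρ).tsum_ofReal_ne_top
  set c : ℝ := l₁ * p₂ / (1 - l₁ * p₂) with hc
  have hc0 : 0 ≤ c := by positivity
  let m : Queue1State → ℝ≥0∞
    | (n, .first) => ENNReal.ofReal (ratio l₁ p₁ p₂ ^ n)
    | (0, .retrans) => 0
    | (n + 1, .retrans) => ENNReal.ofReal (ratio l₁ p₁ p₂ ^ n * c)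
  have hm : ∀ s, m s ≠ ∞ := by
    rintro ⟨_ | k, _ | _⟩ <;> simp [m]
  have hF : ∀ n, (m (n, .first)).toReal = ratio l₁ p₁ p₂ ^ n := fun n =>
    ENNReal.toReal_ofReal (by positivity)
  have hR : ∀ n, (m (n + 1, .retrans)).toReal = ratio l₁ p₁ p₂ ^ n * c := fun n =>
    ENNReal.toReal_ofReal (by positivity)
  have hR0 : (m (0, .retrans)).toReal = 0 := rfl
  have htop : ∑' s, m s ≠ ∞ := by
    rw [tsum_queue1State, tsum_eq_zero_add' (f := fun n => m (n, .retrans)) ENNReal.summable]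
    refine ENNReal.add_ne_top.2 ⟨hgeo, ENNReal.add_ne_top.2 ⟨by simp [m], ?_⟩⟩
    simp only [m, ENNReal.ofReal_mul (pow_nonneg hρ0 _), ENNReal.tsum_mul_right]
    exact ENNReal.mul_ne_top hgeo ENNReal.ofReal_ne_top
  refine exists_isStationary_of_invariant (m := m) ?_ htop fun z => ?_
  · intro h0
    have := ENNReal.tsum_eq_zero.1 h0 (0, .first)
    simp [m] at this
  have hfin : ∑' y, m y * queue1Chain l₁ l₂ p₁ p₂ y z ≠ ∞ :=
    ne_top_of_le_ne_top htop (ENNReal.tsum_le_tsum fun y =>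
      mul_le_of_le_one_right' (PMF.coe_le_one _ _))
  refine (ENNReal.toReal_eq_toReal_iff' hfin (hm z)).1 ?_
  have hρe : ratio l₁ p₁ p₂ * (p₁ * (1 - l₁) * (1 - l₁ * p₂)) =
      l₁ * (1 - p₁ + l₁ * p₁ * p₂) := by
    rw [ratio]
    field_simp
  have hce : c * (1 - l₁ * p₂) = l₁ * p₂ := by
    rw [hc]
    field_simp
  -- Only the defining equations `hρe` and `hce` matter from here; all balance equations become
  -- polynomial identities.
  generalize ratio l₁ p₁ p₂ = ρ at *
  obtain ⟨n, b⟩ := z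
  have hc1 : c = p₁ * p₂ * (l₁ + (1 - l₁) * ρ) := by
    refine mul_right_cancel₀ h3.ne' ?_
    linear_combination hce - (p₂ : ℝ) * hρe
  cases b with
  | first =>
    cases n with
    | zero =>
      rw [balance_zero_first _ _ _ _ hm]
      rw [hF, hF, hR, hR0]
      linear_combination (1 - (l₁ : ℝ)) * hc1 + hρe
    | succ n =>
      rw [balance_succ_first _ _ _ _ hm]
      rw [hF, hF, hF, hR, hR]
      linear_combination (l₁ + (1 - (l₁ : ℝ)) * ρ) * ρ ^ n * hc1 + (ρ - 1) * ρ ^ n * hρe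
  | retrans =>
    cases n with
    | zero => rw [balance_zero_retrans _ _ _ _ hm, hR0]
    | succ n =>
      rw [balance_succ_retrans _ _ _ _ hm, hF, hF, hR]
      linear_combination - ρ ^ n * hc1

end Queue1

/-! ### The service rate of queue 2. -/

section ServiceRate

variable {l₁ l₂ p₁ p₂ : unitInterval} {π : PMF Queue1State}

/-- In phase `first`, queue 1 stays silent either by its coin or, when the coin allows access,
because it is empty and has no arrival. -/
theorem expect_slotLaw_serves2 (l₁ l₂ p₁ p₂ : unitInterval) (s : Queue1State) :
    (expect (slotLaw l₁ l₂ p₁ p₂) fun w => if serves2 s w = true then 1 else 0) =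
      ENNReal.ofReal (p₂ * ((1 - p₁) * (if s.2 = .first then 1 else 0) +
        p₁ * (1 - l₁) * if s = (0, .first) then 1 else 0)) := by
  have hfin : (expect (slotLaw l₁ l₂ p₁ p₂) fun w => if serves2 s w = true then 1 else 0) ≠ ∞ :=
    ne_top_of_le_ne_top ENNReal.one_ne_top
      (expect_le_one _ fun w => by split_ifs <;> simp)
  rw [← ENNReal.ofReal_toReal hfin, toReal_expect_slotLaw _ _ _ _ (fun w => serves2 s w = true)]
  congr 1
  simp only [Fintype.sum_bool]
  rcases s with ⟨_ | k, _ | _⟩ <;> simp [serves2, sends1, sends2, backlog1, coinProb] <;> ring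

theorem serviceRate2_eq (π : PMF Queue1State) :
    serviceRate2 l₁ l₂ p₁ p₂ π = (expect π fun s =>
      expect (slotLaw l₁ l₂ p₁ p₂) fun w => if serves2 s w = true then 1 else 0).toReal := by
  rw [serviceRate2, apply_eq_expect, expect_bind]
  simp only [expect_map]

theorem IsStationary.serviceRate2 (h : IsStationary (queue1Chain l₁ l₂ p₁ p₂) π)
    (hl : 0 < l₁ ∧ l₁ < 1) :
    serviceRate2 l₁ l₂ p₁ p₂ π = p₂ * (1 - l₁ - l₁ * p₂) := by
  have h1 : (0 : ℝ) < 1 - l₁ := sub_pos.2 hl.2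
  have h2 : (0 : ℝ) ≤ 1 - p₁ := sub_nonneg.2 p₁.2.2
  have h3 := p₁.2.1
  have h4 := p₂.2.1
  obtain ⟨hp, -, h0, -, -, hF⟩ := h.geometric hl
  have hp' : (0 : ℝ) < p₁ := hp
  rw [toReal_zero_first_formula hl.2 hp, eq_div_iff (by positivity)] at h0
  have hterm : ∀ n : ℕ, (π (n, .first) * ENNReal.ofReal (p₂ * ((1 - p₁) +
        p₁ * (1 - l₁) * if n = 0 then 1 else 0))).toReal =
      (π (n, .first)).toReal * (p₂ * (1 - p₁)) +
        if n = 0 then (π (0, .first)).toReal * (p₂ * (p₁ * (1 - l₁))) else 0 := by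
    intro n
    rw [ENNReal.toReal_mul, ENNReal.toReal_ofReal (by positivity)]
    split_ifs with hn
    · subst hn; ring
    · ring
  rw [serviceRate2_eq]
  simp only [expect_slotLaw_serves2]
  rw [expect, tsum_queue1State]
  simp only [Prod.mk.injEq, and_true, if_true, mul_one, reduceCtorEq, and_false, if_false,
    mul_zero, add_zero, ENNReal.ofReal_zero, tsum_zero]
  rw [ENNReal.tsum_toReal_eq fun _ =>
    ENNReal.mul_ne_top (π.apply_ne_top _) ENNReal.ofReal_ne_top, tsum_congr hterm,
    Summable.tsum_add ((summable_toReal_and_tsum_eq_one π).1.mul_right _) (summable_of_hasFiniteSupport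
      ((Set.finite_singleton 0).subset fun n hn => by simp at hn; simp [hn.1])),
    tsum_mul_right, hF, tsum_ite_eq]
  linear_combination (p₂ : ℝ) * h0

end ServiceRate

/-! ### Expectations over one slot of the whole system. -/

section System

variable {l₁ l₂ p₁ p₂ : unitInterval}

theorem expect_slotLaw_arrival2 (l₁ l₂ p₁ p₂ : unitInterval) :
    (expect (slotLaw l₁ l₂ p₁ p₂) fun w => if w.arrival2 = true then 1 else 0) =
      ENNReal.ofReal l₂ := by
  have h : ∀ p : unitInterval, ENNReal.ofReal p + ENNReal.ofReal (1 - p) = 1 := fun p => by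
    rw [← ENNReal.ofReal_add p.2.1 (sub_nonneg.2 p.2.2), add_sub_cancel, ENNReal.ofReal_one]
  simp [slotLaw, expect_bind, expect_map, expect_coin, ← add_mul, h]

/-- The expectation over the state of the system and the randomness of the slot. -/
noncomputable def slotExpect (l₁ l₂ p₁ p₂ : unitInterval) (μ : PMF (Queue1State × ℕ))
    (f : Queue1State × ℕ → Slot → ℝ≥0∞) : ℝ≥0∞ :=
  expect μ fun x => expect (slotLaw l₁ l₂ p₁ p₂) (f x)

theorem slotExpect_add (μ : PMF (Queue1State × ℕ)) (f g : Queue1State × ℕ → Slot → ℝ≥0∞) :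
    slotExpect l₁ l₂ p₁ p₂ μ (fun x w => f x w + g x w) =
      slotExpect l₁ l₂ p₁ p₂ μ f + slotExpect l₁ l₂ p₁ p₂ μ g := by
  simp only [slotExpect, expect_add]

theorem slotExpect_mono (μ : PMF (Queue1State × ℕ)) {f g : Queue1State × ℕ → Slot → ℝ≥0∞}
    (h : ∀ x w, f x w ≤ g x w) :
    slotExpect l₁ l₂ p₁ p₂ μ f ≤ slotExpect l₁ l₂ p₁ p₂ μ g :=
  expect_mono _ fun x => expect_mono _ (h x)

theorem slotExpect_tsum (μ : PMF (Queue1State × ℕ)) (f : ℕ → Queue1State × ℕ → Slot → ℝ≥0∞) :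
    slotExpect l₁ l₂ p₁ p₂ μ (fun x w => ∑' n, f n x w) =
      ∑' n, slotExpect l₁ l₂ p₁ p₂ μ (f n) := by
  simp only [slotExpect, expect_tsum]

theorem slotExpect_state (μ : PMF (Queue1State × ℕ)) (f : Queue1State × ℕ → ℝ≥0∞) :
    slotExpect l₁ l₂ p₁ p₂ μ (fun x _ => f x) = expect μ f := by
  simp only [slotExpect, expect_const]

theorem slotExpect_arrival2 (μ : PMF (Queue1State × ℕ)) :
    slotExpect l₁ l₂ p₁ p₂ μ (fun _ w => if w.arrival2 = true then 1 else 0) =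
      ENNReal.ofReal l₂ := by
  simp only [slotExpect, expect_slotLaw_arrival2, expect_const]

theorem expect_bind_systemChain (μ : PMF (Queue1State × ℕ)) (g : Queue1State × ℕ → ℝ≥0∞) :
    expect (μ.bind (systemChain l₁ l₂ p₁ p₂)) g =
      slotExpect l₁ l₂ p₁ p₂ μ fun x w => g (next1 x.1 w, next2 x.1 x.2 w) := by
  simp only [expect_bind, systemChain, expect_map, slotExpect]

/-- `next1` does not look at the number of real packets at queue 2, so queue 1 is an autonomous
factor of the system. -/
theorem map_fst_bind_systemChain (μ : PMF (Queue1State × ℕ)) :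
    (μ.bind (systemChain l₁ l₂ p₁ p₂)).map Prod.fst =
      (μ.map Prod.fst).bind (queue1Chain l₁ l₂ p₁ p₂) := by
  rw [PMF.map_bind, PMF.bind_map]
  congr 1
  funext x
  simp only [systemChain, PMF.map_comp]
  rfl

theorem IsStationary.map_fst {π : PMF (Queue1State × ℕ)}
    (h : IsStationary (systemChain l₁ l₂ p₁ p₂) π) :
    IsStationary (queue1Chain l₁ l₂ p₁ p₂) (π.map Prod.fst) := by
  rw [IsStationary, ← map_fst_bind_systemChain, h]

theorem slotExpect_serves2 {μ : PMF (Queue1State × ℕ)} (hl : 0 < l₁ ∧ l₁ < 1)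
    (h : IsStationary (queue1Chain l₁ l₂ p₁ p₂) (μ.map Prod.fst)) :
    slotExpect l₁ l₂ p₁ p₂ μ (fun x w => if serves2 x.1 w = true then 1 else 0) =
      ENNReal.ofReal (p₂ * (1 - l₁ - l₁ * p₂)) := by
  rw [← h.serviceRate2 hl, serviceRate2_eq, ENNReal.ofReal_toReal, expect_map]
  · rfl
  · exact ne_top_of_le_ne_top ENNReal.one_ne_top (expect_le_one _ fun s =>
      expect_le_one _ fun w => by split_ifs <;> simp)

/-! ### Draining the system. -/

/-- One slot without arrivals in which both access coins allow a transmission. -/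
def drain (x : Queue1State × ℕ) : Queue1State × ℕ :=
  (next1 x.1 ⟨false, false, true, true⟩, next2 x.1 x.2 ⟨false, false, true, true⟩)

theorem drain_empty : drain ((0, .first), 0) = ((0, .first), 0) := rfl

theorem drain_iterate_empty (m : ℕ) : drain^[m] ((0, .first), 0) = ((0, .first), 0) :=
  Function.iterate_fixed drain_empty m

/-- From phase `first`, a collision followed by a retransmission removes one packet of queue 1 in
two slots; once queue 1 is empty, each slot removes one packet of queue 2. -/
theorem exists_drain_iterate_eq (x : Queue1State × ℕ) :
    ∃ m, drain^[m] x = ((0, .first), 0) := by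
  have hpre : ∀ x, (∃ m, drain^[m] (drain x) = ((0, .first), 0)) →
      ∃ m, drain^[m] x = ((0, .first), 0) := fun x ⟨m, hm⟩ => ⟨m + 1, hm⟩
  have hfirst : ∀ k n, ∃ m, drain^[m] ((k, .first), n) = ((0, .first), 0) := by
    intro k n
    induction k with
    | zero =>
      induction n with
      | zero => exact ⟨0, rfl⟩
      | succ n ih => exact hpre _ ih
    | succ k ih =>
      refine hpre _ (hpre _ ?_)
      simpa [drain, next1, next2, sends1, sends2, serves2, backlog1] using ih
  obtain ⟨⟨k, b⟩, n⟩ := x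
  cases b with
  | first => exact hfirst k n
  | retrans =>
    refine hpre _ ?_
    rcases k with _ | k <;>
      simpa [drain, next1, next2, sends1, sends2, serves2, backlog1] using hfirst _ n

theorem pow_mul_expect_drain_le {ν : ℕ → PMF (Queue1State × ℕ)}
    (hν : ∀ n, ν (n + 1) = (ν n).bind (systemChain l₁ l₂ p₁ p₂)) (m n : ℕ)
    (g : Queue1State × ℕ → ℝ≥0∞) :
    slotLaw l₁ l₂ p₁ p₂ ⟨false, false, true, true⟩ ^ m *
      (expect (ν n) fun x => g (drain^[m] x)) ≤ expect (ν (n + m)) g := by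
  induction m generalizing g with
  | zero => simp
  | succ m ih =>
    rw [← Nat.add_assoc, hν, expect_bind_systemChain]
    calc _ = slotLaw l₁ l₂ p₁ p₂ ⟨false, false, true, true⟩ *
          (slotLaw l₁ l₂ p₁ p₂ ⟨false, false, true, true⟩ ^ m *
            expect (ν n) fun x => g (drain (drain^[m] x))) := by
          simp only [Function.iterate_succ_apply', pow_succ']
          ring
      _ ≤ slotLaw l₁ l₂ p₁ p₂ ⟨false, false, true, true⟩ *
          expect (ν (n + m)) fun x => g (drain x) := by
          gcongr
          exact ih fun x => g (drain x)
      _ ≤ _ := by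
          rw [← expect_const_mul]
          exact expect_mono _ fun x => mul_le_expect (slotLaw l₁ l₂ p₁ p₂)
            (fun w => g (next1 x.1 w, next2 x.1 x.2 w)) _

theorem IsStationary.apply_empty_ne_zero {π : PMF (Queue1State × ℕ)}
    (h : IsStationary (systemChain l₁ l₂ p₁ p₂) π)
    (hq : slotLaw l₁ l₂ p₁ p₂ ⟨false, false, true, true⟩ ≠ 0) : π ((0, .first), 0) ≠ 0 := by
  obtain ⟨x, hx⟩ := π.support_nonempty
  obtain ⟨m, hm⟩ := exists_drain_iterate_eq x
  have := pow_mul_expect_drain_le (ν := fun _ => π) (fun _ => h.symm) m 0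
    fun y => if y = ((0, .first), 0) then 1 else 0
  rw [← apply_eq_expect] at this
  refine (lt_of_lt_of_le ?_ this).ne'
  have h1 := mul_le_expect π
    (fun y => if drain^[m] y = ((0, .first), 0) then 1 else 0) x
  simp only [hm, if_true, mul_one] at h1
  exact pos_iff_ne_zero.2 (mul_ne_zero (pow_ne_zero _ hq)
    (lt_of_lt_of_le (pos_iff_ne_zero.2 hx) h1).ne')

/-! ### Necessity of the load conditions. -/

/-- The rate balance of queue 2 in a stationary system. The last term is the rate at which dummy
packets are delivered in slots without an arrival. -/
theorem IsStationary.rate_balance {π : PMF (Queue1State × ℕ)} (hl : 0 < l₁ ∧ l₁ < 1)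
    (h : IsStationary (systemChain l₁ l₂ p₁ p₂) π) :
    ENNReal.ofReal (p₂ * (1 - l₁ - l₁ * p₂)) = ENNReal.ofReal l₂ +
      slotExpect l₁ l₂ p₁ p₂ π (fun x w =>
        if x.2 = 0 ∧ w.arrival2 = false ∧ serves2 x.1 w = true then 1 else 0) := by
  -- Level crossings are compared one level at a time and then summed, since the stationary mean
  -- length of queue 2 is not known to be finite.
  have cut : ∀ n : ℕ, slotExpect l₁ l₂ p₁ p₂ π (fun x w =>
        if x.2 = n + 1 ∧ w.arrival2 = false ∧ serves2 x.1 w = true then 1 else 0) =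
      slotExpect l₁ l₂ p₁ p₂ π (fun x w =>
        if x.2 = n ∧ w.arrival2 = true ∧ serves2 x.1 w = false then 1 else 0) := by
    intro n
    have hne : expect π (fun x => if n < x.2 then 1 else 0) ≠ ∞ :=
      ne_top_of_le_ne_top ENNReal.one_ne_top (expect_le_one _ fun x => by split_ifs <;> simp)
    refine (ENNReal.add_right_inj hne).1 ?_
    have e : slotExpect l₁ l₂ p₁ p₂ π (fun x w => if n < next2 x.1 x.2 w then 1 else 0) =
        expect π (fun x => if n < x.2 then 1 else 0) := by
      rw [← expect_bind_systemChain π (fun x => if n < x.2 then 1 else 0), h]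
    conv_lhs => rw [← e]
    conv_rhs => rw [← slotExpect_state (l₁ := l₁) (l₂ := l₂) (p₁ := p₁) (p₂ := p₂)]
    rw [← slotExpect_add, ← slotExpect_add]
    congr 1
    funext x w
    rcases Bool.eq_false_or_eq_true w.arrival2 with hA | hA <;>
      rcases Bool.eq_false_or_eq_true (serves2 x.1 w) with hS | hS <;> simp [next2, hA, hS]
    all_goals split_ifs <;> first | omega | simp
  have hsum : slotExpect l₁ l₂ p₁ p₂ π (fun x w =>
        if 0 < x.2 ∧ w.arrival2 = false ∧ serves2 x.1 w = true then 1 else 0) =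
      slotExpect l₁ l₂ p₁ p₂ π (fun x w =>
        if w.arrival2 = true ∧ serves2 x.1 w = false then 1 else 0) := by
    have := tsum_congr (L := .unconditional ℕ) cut
    rw [← slotExpect_tsum, ← slotExpect_tsum] at this
    refine (congrArg _ (funext fun x => funext fun w => ?_)).trans
      (this.trans (congrArg _ (funext fun x => funext fun w => ?_)))
    · rcases x with ⟨s, _ | n⟩
      · simp
      · rw [tsum_eq_single n fun k hk => by simp [hk.symm]]
        simp
    · rw [tsum_eq_single x.2 fun k hk => by simp [hk.symm]]
      simp
  rw [← slotExpect_serves2 hl h.map_fst, ← slotExpect_arrival2 (l₁ := l₁) (p₁ := p₁) (p₂ := p₂) π]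
  have e1 : (fun (x : Queue1State × ℕ) (w : Slot) =>
      if serves2 x.1 w = true then (1 : ℝ≥0∞) else 0) = fun x w =>
        ((if 0 < x.2 ∧ w.arrival2 = false ∧ serves2 x.1 w = true then 1 else 0) +
        (if w.arrival2 = true ∧ serves2 x.1 w = true then 1 else 0)) +
        (if x.2 = 0 ∧ w.arrival2 = false ∧ serves2 x.1 w = true then 1 else 0) := by
    funext ⟨s, n⟩ w
    cases w.arrival2 <;> cases serves2 s w <;> rcases n with _ | n <;> simp
  have e2 : (fun (_ : Queue1State × ℕ) (w : Slot) =>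
      if w.arrival2 = true then (1 : ℝ≥0∞) else 0) = fun x w =>
        (if w.arrival2 = true ∧ serves2 x.1 w = false then 1 else 0) +
        (if w.arrival2 = true ∧ serves2 x.1 w = true then 1 else 0) := by
    funext ⟨s, n⟩ w
    cases w.arrival2 <;> cases serves2 s w <;> simp
  rw [e1, e2, slotExpect_add, slotExpect_add, slotExpect_add, hsum]

theorem IsStationary.load_lt {π : PMF (Queue1State × ℕ)} (hl₁ : 0 < l₁ ∧ l₁ < 1)
    (hl₂ : 0 < l₂ ∧ l₂ < 1) (h : IsStationary (systemChain l₁ l₂ p₁ p₂) π) :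
    (l₁ : ℝ) < p₁ / (1 + p₁ * p₂) ∧ (l₂ : ℝ) < p₂ * (1 - l₁ - l₁ * p₂) := by
  have hl : (0 : ℝ) < l₂ := hl₂.1
  obtain ⟨hp₁, hρ, -⟩ := h.map_fst.geometric hl₁
  refine ⟨(ratio_lt_one_iff hl₁.2 hp₁).1 hρ, ?_⟩
  have hbal := h.rate_balance hl₁
  have hp₂ : 0 < p₂ := by
    rcases p₂.2.1.lt_or_eq with hp | hp
    · exact hp
    · rw [← hp, zero_mul, ENNReal.ofReal_zero] at hbal
      have := (add_eq_zero.1 hbal.symm).1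
      rw [ENNReal.ofReal_eq_zero] at this
      exact absurd hl this.not_gt
  have hq := slotLaw_apply_pos hl₁.2 hl₂.2 hp₁ hp₂
  -- In the empty system the draining slot delivers a dummy, and both the state and the slot have
  -- positive probability.
  have hd : slotExpect l₁ l₂ p₁ p₂ π (fun x w =>
        if x.2 = 0 ∧ w.arrival2 = false ∧ serves2 x.1 w = true then 1 else 0) ≠ 0 := by
    refine (lt_of_lt_of_le ?_ (mul_le_expect π _ ((0, .first), 0))).ne'
    refine pos_iff_ne_zero.2 (mul_ne_zero (h.apply_empty_ne_zero hq) ?_)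
    refine (lt_of_lt_of_le (pos_iff_ne_zero.2 hq) ?_).ne'
    refine le_trans ?_ (mul_le_expect (slotLaw l₁ l₂ p₁ p₂) _ ⟨false, false, true, true⟩)
    simp [serves2, sends1, sends2, backlog1]
  refine (ENNReal.ofReal_lt_ofReal_iff_of_nonneg hl.le).1 ?_
  rw [hbal]
  exact ENNReal.lt_add_right ENNReal.ofReal_ne_top hd

/-! ### Sufficiency of the load conditions. -/

theorem exists_finset_expect_compl_le {S : Type*} (π : PMF S) {ε : ℝ≥0∞} (hε : ε ≠ 0) :
    ∃ F : Finset S, ∀ [DecidablePred (· ∈ F)], expect π (fun s => if s ∈ F then 0 else 1) ≤ ε := by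
  have h := ENNReal.tendsto_tsum_compl_atTop_zero (f := π) (by rw [π.tsum_coe]; simp)
  obtain ⟨F, hF⟩ := (h.eventually_lt_const (pos_iff_ne_zero.2 hε)).exists
  refine ⟨F, fun {_} => le_trans (le_of_eq ?_) hF.le⟩
  refine Eq.trans ?_ (tsum_subtype {x | x ∉ F} fun s => π s).symm
  refine tsum_congr fun s => ?_
  by_cases hs : s ∈ F <;> simp [hs]

/-- A drift argument: the mean length of queue 2 cannot become negative, so the slack in the load
must be made up by slots in which it is empty. -/
theorem isPositiveRecurrent_systemChain (hl₁ : 0 < l₁ ∧ l₁ < 1)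
    (hl₂ : 0 < l₂ ∧ l₂ < 1) (h₁ : (l₁ : ℝ) < p₁ / (1 + p₁ * p₂))
    (h₂ : (l₂ : ℝ) < p₂ * (1 - l₁ - l₁ * p₂)) :
    IsPositiveRecurrent (systemChain l₁ l₂ p₁ p₂) ((0, .first), 0) := by
  classical
  obtain ⟨π, hπ⟩ := exists_isStationary_queue1Chain (l₂ := l₂) hl₁ h₁
  have hp₁ := (hπ.geometric hl₁).1
  have hp₂ : 0 < p₂ := by
    rcases p₂.2.1.lt_or_eq with hp | hp
    · exact hp
    · rw [← hp, zero_mul] at h₂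
      exact absurd h₂ l₂.2.1.not_gt
  have hq := slotLaw_apply_pos hl₁.2 hl₂.2 hp₁ hp₂
  set q := slotLaw l₁ l₂ p₁ p₂ ⟨false, false, true, true⟩ with hqdef
  -- the chain started with queue 1 stationary and queue 2 empty
  let ν : ℕ → PMF (Queue1State × ℕ) := fun n =>
    Nat.rec (π.map fun s => (s, 0)) (fun _ μ => μ.bind (systemChain l₁ l₂ p₁ p₂)) n
  have hν : ∀ n, ν (n + 1) = (ν n).bind (systemChain l₁ l₂ p₁ p₂) := fun n => rfl
  have hfst : ∀ n, (ν n).map Prod.fst = π := by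
    intro n
    induction n with
    | zero =>
      change (π.map fun s => (s, 0)).map Prod.fst = π
      rw [PMF.map_comp]
      exact PMF.map_id π
    | succ n ih => rw [hν, map_fst_bind_systemChain, ih, hπ]
  -- Half of the slack: one `ε` pays for queue 1 leaving the finite set `F`, the other remains as
  -- the frequency bound.
  set δ : ℝ := (p₂ * (1 - l₁ - l₁ * p₂) - l₂) / 2 with hδdef
  have hδ : 0 < δ := half_pos (sub_pos.2 h₂)
  set ε := ENNReal.ofReal δ with hεdef
  have hε : ε ≠ 0 := (ENNReal.ofReal_pos.2 hδ).ne'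
  have hμ : ENNReal.ofReal (p₂ * (1 - l₁ - l₁ * p₂)) = ENNReal.ofReal l₂ + ε + ε := by
    rw [hεdef, ← ENNReal.ofReal_add l₂.2.1 hδ.le,
      ← ENNReal.ofReal_add (add_nonneg l₂.2.1 hδ.le) hδ.le]
    congr 1
    rw [hδdef]
    ring
  obtain ⟨F, hF⟩ := exists_finset_expect_compl_le π hε
  -- The indicator of an empty queue 2 absorbs the truncated subtraction in `next2`.
  have hstep : ∀ n, expect (ν (n + 1)) (fun x => (x.2 : ℝ≥0∞)) +
        ENNReal.ofReal (p₂ * (1 - l₁ - l₁ * p₂)) ≤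
      expect (ν n) (fun x => (x.2 : ℝ≥0∞)) + ENNReal.ofReal l₂ +
        expect (ν n) (fun x => if x.2 = 0 then 1 else 0) := by
    intro n
    rw [← slotExpect_serves2 (μ := ν n) hl₁ (by rw [hfst]; exact hπ), hν,
      expect_bind_systemChain, ← slotExpect_arrival2 (l₁ := l₁) (p₁ := p₁) (p₂ := p₂) (ν n),
      ← slotExpect_state (l₁ := l₁) (l₂ := l₂) (p₁ := p₁) (p₂ := p₂) (ν n) fun x => (x.2 : ℝ≥0∞),
      ← slotExpect_state (l₁ := l₁) (l₂ := l₂) (p₁ := p₁) (p₂ := p₂) (ν n)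
        fun x => if x.2 = 0 then 1 else 0, ← slotExpect_add, ← slotExpect_add, ← slotExpect_add]
    refine slotExpect_mono _ fun x w => ?_
    obtain ⟨s, n⟩ := x
    simp only [next2]
    cases w.arrival2 <;> cases serves2 s w <;> rcases n with _ | n <;> simp
  have hsplit : ∀ n, expect (ν n) (fun x => if x.2 = 0 then 1 else 0) ≤
      expect (ν n) (fun x => if x.1 ∈ F ∧ x.2 = 0 then 1 else 0) + ε := by
    intro n
    calc _ ≤ expect (ν n) (fun x => (if x.1 ∈ F ∧ x.2 = 0 then 1 else 0) +
          if x.1 ∈ F then 0 else 1) := by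
          refine expect_mono _ fun x => ?_
          by_cases hx : x.1 ∈ F <;> simp [hx]
          split_ifs <;> simp
      _ = expect (ν n) (fun x => if x.1 ∈ F ∧ x.2 = 0 then 1 else 0) +
          expect π (fun s => if s ∈ F then 0 else 1) := by
          rw [expect_add, ← hfst n, expect_map]
      _ ≤ _ := by gcongr; exact hF
  have hsum : ∀ n : ℕ, expect (ν n) (fun x => (x.2 : ℝ≥0∞)) + n * ε ≤
      ∑ i ∈ Finset.range n, expect (ν i) (fun x => if x.1 ∈ F ∧ x.2 = 0 then 1 else 0) := by
    intro n
    induction n with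
    | zero =>
      change expect (π.map fun s => (s, 0)) (fun x : Queue1State × ℕ => (x.2 : ℝ≥0∞)) + _ ≤ _
      rw [expect_map]
      simp [expect_const]
    | succ n ih =>
      rw [Finset.sum_range_succ]
      refine (ENNReal.add_le_add_iff_right
        (ENNReal.add_ne_top.2 ⟨ENNReal.ofReal_ne_top (r := l₂), ENNReal.ofReal_ne_top (r := δ)⟩)).1 ?_
      have := (hstep n).trans (add_le_add_right (hsplit n) _)
      rw [hμ] at this
      calc _ = (expect (ν (n + 1)) (fun x => (x.2 : ℝ≥0∞)) + (ENNReal.ofReal l₂ + ε + ε)) +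
            n * ε := by push_cast; ring
        _ ≤ _ := add_le_add_left this _
        _ = (expect (ν n) (fun x => (x.2 : ℝ≥0∞)) + n * ε) +
            expect (ν n) (fun x => if x.1 ∈ F ∧ x.2 = 0 then 1 else 0) +
              (ENNReal.ofReal l₂ + ε) := by ring
        _ ≤ _ := by gcongr
  choose M hM using exists_drain_iterate_eq
  -- A common draining time for all of `F`: the empty state is fixed by `drain`, so shorter times
  -- can be padded. Using `m + 1` steps matches the index `i + 1` in the frequency criterion,
  -- applied to `ν` shifted by `m`.
  set m := F.sup fun s => M (s, 0) with hm
  have hdrain : ∀ s ∈ F, drain^[m + 1] (s, 0) = ((0, .first), 0) := by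
    intro s hs
    have hle : M (s, 0) ≤ m + 1 := (Finset.le_sup (f := fun s => M (s, 0)) hs).trans m.le_succ
    obtain ⟨j, hj⟩ := Nat.exists_eq_add_of_le' hle
    rw [hj, Function.iterate_add_apply, hM, drain_iterate_empty]
  have hvisit : ∀ i, q ^ (m + 1) *
      expect (ν i) (fun x => if x.1 ∈ F ∧ x.2 = 0 then 1 else 0) ≤
        ν (i + 1 + m) ((0, .first), 0) := by
    intro i
    rw [apply_eq_expect, show i + 1 + m = i + (m + 1) by omega]
    refine le_trans ?_ (pow_mul_expect_drain_le hν (m + 1) i _)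
    rw [← hqdef]
    gcongr
    refine expect_mono _ fun x => ?_
    obtain ⟨s, n⟩ := x
    split_ifs with hx hx'
    · exact le_rfl
    · obtain ⟨hs, rfl⟩ := hx
      exact absurd (hdrain s hs) hx'
    all_goals simp
  have hq1 : q ≠ ∞ := PMF.apply_ne_top _ _
  refine isPositiveRecurrent_of_frequency (ν := fun n => ν (n + m)) (c := q ^ (m + 1) * ε)
    (fun n => by
      rw [Nat.add_right_comm, hν]) (mul_ne_zero (pow_ne_zero _ hq) hε)
    (ENNReal.mul_ne_top (ENNReal.pow_ne_top hq1) ENNReal.ofReal_ne_top) fun n => ?_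
  calc q ^ (m + 1) * ε * n = q ^ (m + 1) * (n * ε) := by ring
    _ ≤ q ^ (m + 1) * ∑ i ∈ Finset.range n,
          expect (ν i) (fun x => if x.1 ∈ F ∧ x.2 = 0 then 1 else 0) := by
        gcongr
        exact le_add_self.trans (hsum n)
    _ ≤ _ := by
        rw [Finset.mul_sum]
        exact Finset.sum_le_sum fun i _ => hvisit i

end System

end FeedbackAccess

/-! ### The equivalences combined. -/

theorem lemma1 (l₁ l₂ p₁ p₂ : unitInterval)
    (hl₁ : 0 < l₁ ∧ l₁ < 1) (hl₂ : 0 < l₂ ∧ l₂ < 1) :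
    -- stability of queue 1
    ((∃ π, FeedbackAccess.IsStationary (FeedbackAccess.queue1Chain l₁ l₂ p₁ p₂) π) ↔
      (l₁ : ℝ) < p₁ / (1 + p₁ * p₂)) ∧
    (FeedbackAccess.IsPositiveRecurrent (FeedbackAccess.queue1Chain l₁ l₂ p₁ p₂) (0, .first) ↔
      (l₁ : ℝ) < p₁ / (1 + p₁ * p₂)) ∧
    -- the stationary distribution of queue 1 and the service rate of queue 2
    ((l₁ : ℝ) < p₁ / (1 + p₁ * p₂) →
      ∃! π, FeedbackAccess.IsStationary (FeedbackAccess.queue1Chain l₁ l₂ p₁ p₂) π) ∧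
    (∀ π, FeedbackAccess.IsStationary (FeedbackAccess.queue1Chain l₁ l₂ p₁ p₂) π →
      0 ≤ FeedbackAccess.ratio l₁ p₁ p₂ ∧ FeedbackAccess.ratio l₁ p₁ p₂ < 1 ∧
      0 < (π (0, .first)).toReal ∧
      (π (0, .first)).toReal = (p₁ - l₁ * (1 + p₁ * p₂)) / (p₁ * (1 - l₁)) ∧
      (∀ k : ℕ, (π (k, .first)).toReal =
        FeedbackAccess.ratio l₁ p₁ p₂ ^ k * (π (0, .first)).toReal) ∧
      (π (0, .retrans)).toReal = 0 ∧
      (∀ k : ℕ, (π (k + 1, .retrans)).toReal =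
        FeedbackAccess.ratio l₁ p₁ p₂ ^ k * (l₁ * p₂ / (1 - l₁ * p₂)) *
          (π (0, .first)).toReal) ∧
      FeedbackAccess.serviceRate2 l₁ l₂ p₁ p₂ π = p₂ * (1 - l₁ - l₁ * p₂)) ∧
    -- stability of the whole system
    (FeedbackAccess.IsPositiveRecurrent (FeedbackAccess.systemChain l₁ l₂ p₁ p₂)
        ((0, .first), 0) ↔
      (l₁ : ℝ) < p₁ / (1 + p₁ * p₂) ∧ (l₂ : ℝ) < p₂ * (1 - l₁ - l₁ * p₂)) ∧
    ((∃ π, FeedbackAccess.IsStationary (FeedbackAccess.systemChain l₁ l₂ p₁ p₂) π) ↔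
      (l₁ : ℝ) < p₁ / (1 + p₁ * p₂) ∧ (l₂ : ℝ) < p₂ * (1 - l₁ - l₁ * p₂)) := by
  open FeedbackAccess in
  have hone : (∃ π, IsStationary (queue1Chain l₁ l₂ p₁ p₂) π) ↔
      (l₁ : ℝ) < p₁ / (1 + p₁ * p₂) :=
    ⟨fun ⟨_, hπ⟩ => (ratio_lt_one_iff hl₁.2 (hπ.geometric hl₁).1).1 (hπ.geometric hl₁).2.1,
      exists_isStationary_queue1Chain hl₁⟩
  open FeedbackAccess in
  have hpos : ∀ π, IsStationary (queue1Chain l₁ l₂ p₁ p₂) π → 0 < (π (0, .first)).toReal := by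
    intro π hπ
    obtain ⟨-, hρ, h0, -⟩ := hπ.geometric hl₁
    rw [h0]
    exact mul_pos (sub_pos.2 hρ) (one_sub_mul_pos hl₁.2)
  refine ⟨hone, ⟨fun h => hone.1 h.exists_isStationary, fun h => ?_⟩, fun h => ?_,
    fun π hπ => ?_, ⟨fun h => ?_, fun h => ?_⟩, fun ⟨π, hπ⟩ => hπ.load_lt hl₁ hl₂, fun h => ?_⟩
  · obtain ⟨π, hπ⟩ := hone.2 h
    exact hπ.isPositiveRecurrent fun h0 => (hpos π hπ).ne' (by rw [h0, ENNReal.toReal_zero])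
  · obtain ⟨π, hπ⟩ := hone.2 h
    exact ⟨π, hπ, fun π' hπ' => hπ'.unique hl₁ hπ⟩
  · obtain ⟨hp, hρ, h0, hF, hR, -⟩ := hπ.geometric hl₁
    exact ⟨FeedbackAccess.ratio_nonneg hl₁.2, hρ, hpos π hπ,
      h0.trans (FeedbackAccess.toReal_zero_first_formula hl₁.2 hp), hF, hπ.toReal_zero_retrans,
      hR, hπ.serviceRate2 hl₁⟩
  · obtain ⟨π, hπ⟩ := h.exists_isStationary
    exact hπ.load_lt hl₁ hl₂
  · exact FeedbackAccess.isPositiveRecurrent_systemChain hl₁ hl₂ h.1 h.2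
  · exact (FeedbackAccess.isPositiveRecurrent_systemChain hl₁ hl₂ h.1 h.2).exists_isStationary
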